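/- Consider a stochastic $K$-armed bandit, $K \ge 1$: in round $t = 1, 2, \dots$ a reward vector $Y_t = (Y_{1,t}, \dots, Y_{K,t}) \in [0,1]^K$ is realized, the vectors $Y_1, Y_2, \dots$ are i.i.d., and $\mu_i = \mathbb{E}[Y_{i,t}]$. The agent pulls an arm $I_t$ and observes only $Y_{I_t,t}$. Let arm $1$ be the unique optimal arm, that is, $\mu_1 > \mu_i$ for all $i \ge 2$, and let $\Delta_i = \mu_1 - \mu_i$. The policy SoftElim with parameter $w > 0$ pulls each arm once in the first $K$ rounds (in any fixed order); in every round $t > K$ it pulls arm $i$, given the past observations, with probability $$\pi_{i,t} = \frac{\exp[-S_{i,t}/w^2]}{\sum_{j=1}^K \exp[-S_{j,t}/w^2]}, \qquad S_{i,t} = 2\Big(\max_{j} \hat\mu_{j,t-1} - \hat\mu_{i,t-1}\Big)^2 T_{i,t-1},$$ where $T_{i,t-1}$ is the number of pulls of arm $i$ in the first $t-1$ rounds and $\hat\mu_{i,t-1}$ is the average of the rewards observed in them. Let $w = \sqrt 8$. Then for every $n \ge 1$ the expected $n$-round regret $R(n) = \mathbb{E}\big[\sum_{t=1}^n (Y_{1,t}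 - Y_{I_t,t})\big]$ satisfies $$R(n) \le \sum_{i=2}^K \left[(2e+1)\left(\frac{16}{\Delta_i}\log n + \Delta_i\right) + 5\Delta_i\right].$$ In particular, for a fixed bandit instance, $R(n) = O(\log n)$ as $n \to \infty$. -/

import Mathlib

open MeasureTheory

namespace Bandit

/-- What the agent has observed in the first `t` rounds: for each of them, the pulled arm and the
reward of that arm. -/
abbrev History (K t : ℕ) : Type := Fin t → Fin K × ℝ

/-- A randomized policy for `K` arms: `π t h i` is the probability of pulling arm `i` in round
`t + 1`, given the history `h` of the first `t` rounds. -/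
abbrev Policy (K : ℕ) : Type := (t : ℕ) → History K t → Fin K → ℝ

/-- The history of the first `t` rounds, when the rewards of all arms in all rounds are `Y` and the
pulled arms are `I`: the agent sees only the rewards of the pulled arms. -/
def history {K n : ℕ} (Y : Fin n → Fin K → ℝ) (I : Fin n → Fin K) (t : Fin n) :
    History K (t : ℕ) :=
  fun l => (I (Fin.castLE t.isLt.le l), Y (Fin.castLE t.isLt.le l) (I (Fin.castLE t.isLt.le l)))

/-- The probability that the policy `π` pulls the sequence of arms `I` in `n` rounds when the
realized rewards are `Y`: in each round the arm is drawn from `π` given the history so far. -/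
noncomputable def pullProb {K n : ℕ} (π : Policy K) (Y : Fin n → Fin K → ℝ)
    (I : Fin n → Fin K) : ℝ :=
  ∏ t : Fin n, π (t : ℕ) (history Y I t) (I t)

/-- The expected `n`-round regret of `π` against the arm `a` (the optimal arm). The law of the
reward vector `(Y_{i,t})_i` of one round is `ν`, and the reward vectors of the `n` rounds are
i.i.d.; the expectation is over the realized rewards `Y` and the pulled arms `I`. -/
noncomputable def regret {K : ℕ} (ν : Measure (Fin K → ℝ)) (π : Policy K) (a : Fin K)
    (n : ℕ) : ℝ :=
  ∫ Y : Fin n → Fin K → ℝ,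
    ∑ I : Fin n → Fin K, pullProb π Y I * ∑ t : Fin n, (Y t a - Y t (I t))
    ∂(Measure.pi fun _ : Fin n => ν)

/-- The mean reward of arm `i`. -/
noncomputable def mean {K : ℕ} (ν : Measure (Fin K → ℝ)) (i : Fin K) : ℝ :=
  ∫ y, y i ∂ν

/-- The gap of arm `i` to arm `a`. -/
noncomputable def gap {K : ℕ} (ν : Measure (Fin K → ℝ)) (a i : Fin K) : ℝ :=
  mean ν a - mean ν i

/-- The number of pulls of arm `i` in a history. -/
def pulls {K t : ℕ} (h : History K t) (i : Fin K) : ℕ :=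
  (Finset.univ.filter fun l : Fin t => (h l).1 = i).card

/-- The empirical mean reward of arm `i` in a history (used only when `i` has been pulled). -/
noncomputable def empMean {K t : ℕ} (h : History K t) (i : Fin K) : ℝ :=
  (∑ l : Fin t, if (h l).1 = i then (h l).2 else 0) / (pulls h i : ℝ)

/-- The score of arm `i`: twice the squared empirical gap, times the number of pulls. -/
noncomputable def score {K t : ℕ} (h : History K t) (i : Fin K) : ℝ :=
  2 * ((⨆ j : Fin K, empMean h j) - empMean h i) ^ 2 * (pulls h i : ℝ)

/-- The policy SoftElim with exploration parameter `w`: in the first `K` rounds it pulls each arm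
once, in the order `σ`; afterwards it pulls arm `i` with probability proportional to
`exp (- score / w ^ 2)`. -/
noncomputable def softElim {K : ℕ} (σ : Equiv.Perm (Fin K)) (w : ℝ) : Policy K :=
  fun t h i =>
    if ht : t < K then
      if i = σ ⟨t, ht⟩ then 1 else 0
    else
      Real.exp (-score h i / w ^ 2) / ∑ j : Fin K, Real.exp (-score h j / w ^ 2)

end Bandit

namespace Bandit

open scoped ENNReal

/-! Regret is the sum of the gaps times the expected pull counts (`regret_eq_sum_gap_mul`), so it
suffices to bound the pulls of one suboptimal arm `i` of gap `d`. Let `b` lie `d / 4` above its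
mean, and `a` lie `d / 4` below the optimal mean.

After initialization, there are four ways to pull `i` (`softElim_le`). It has fewer than `N ≈ 16 log
n / d ^ 2` pulls; its average exceeds `b`; both fail and the largest average is at least `a`, so its
score forces probability at most `1 / n`; or the largest average is below `a`. In the last case the
softmax ratio transfers the probability to the optimal arm at the price `exp (score / 8)`, and that
score is controlled by how far this arm's average falls below `a`.

Each cost is now paid at a pull of an arm and depends only on that arm's pull count and reward sum.
Even under adaptive sampling, its expected total is at most the sum over `s` of its mean after `s`
independent rewards (`sum_expect_pull_le`). Hoeffding's lemma makes these means decay like `exp (-s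
d ^ 2 / 8)`, even for the exponential price, because that price grows more slowly than the Gaussian
tail decays. Geometric series then give `7 + 16 log n / d ^ 2 + 32 / d ^ 2` expected pulls for `n ≥
2`. -/

/-- The history of all `n` rounds. -/
def fullHistory {K n : ℕ} (Y : Fin n → Fin K → ℝ) (I : Fin n → Fin K) : History K n :=
  fun l => (I l, Y l (I l))

/-- The history `h` followed by one more round. -/
abbrev History.snoc {K n : ℕ} (h : History K n) (p : Fin K × ℝ) : History K (n + 1) :=
  Fin.snoc (α := fun _ => Fin K × ℝ) h p

/-- The sum of the rewards observed from arm `i` in a history. -/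
def rewardSum {K t : ℕ} (h : History K t) (i : Fin K) : ℝ :=
  ∑ l : Fin t, if (h l).1 = i then (h l).2 else 0

/-- The expectation of a function of the first `n` rounds. -/
noncomputable def expect {K : ℕ} (ν : Measure (Fin K → ℝ)) (π : Policy K) (n : ℕ)
    (f : History K n → ℝ≥0∞) : ℝ≥0∞ :=
  ∫⁻ Y : Fin n → Fin K → ℝ,
    ∑ I : Fin n → Fin K, ENNReal.ofReal (pullProb π Y I) * f (fullHistory Y I)
    ∂(Measure.pi fun _ : Fin n => ν)

/-- The policy chooses its arms by probability vectors that depend measurably on the history. -/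
structure IsRandomized {K : ℕ} (π : Policy K) : Prop where
  measurable : ∀ t i, Measurable fun h => π t h i
  nonneg : ∀ t h i, 0 ≤ π t h i
  sum_eq_one : ∀ t h, ∑ i, π t h i = 1

/-! ### Histories, their measurability, and appending one round -/

section Basic

variable {K n : ℕ}

theorem measurable_finSnoc {α : Type*} [MeasurableSpace α] :
    Measurable fun p : (Fin n → α) × α => Fin.snoc (α := fun _ => α) p.1 p.2 := by
  refine measurable_pi_lambda _ fun l => ?_
  induction l using Fin.lastCases with
  | last => simpa using measurable_snd
  | cast l =>
    simp only [Fin.snoc_castSucc]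
    exact (measurable_pi_apply l).comp measurable_fst

theorem measurable_history (I : Fin n → Fin K) (t : Fin n) :
    Measurable fun Y : Fin n → Fin K → ℝ => history Y I t := by
  refine measurable_pi_lambda _ fun l => ?_
  exact measurable_const.prodMk
    ((measurable_pi_apply _).comp (measurable_pi_apply (Fin.castLE t.isLt.le l)))

theorem measurable_fullHistory (I : Fin n → Fin K) :
    Measurable fun Y : Fin n → Fin K → ℝ => fullHistory Y I := by
  refine measurable_pi_lambda _ fun l => ?_
  exact measurable_const.prodMk ((measurable_pi_apply _).comp (measurable_pi_apply l))

theorem measurable_pulls (i : Fin K) : Measurable fun h : History K n => pulls h i := by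
  simp only [pulls, Finset.card_filter]
  refine Finset.measurable_sum _ fun l _ => ?_
  refine Measurable.ite ?_ measurable_const measurable_const
  exact (measurable_fst.comp (measurable_pi_apply l)) (measurableSet_singleton i)

theorem measurable_rewardSum (i : Fin K) : Measurable fun h : History K n => rewardSum h i := by
  refine Finset.measurable_sum _ fun l _ => ?_
  refine Measurable.ite ?_ (measurable_snd.comp (measurable_pi_apply l)) measurable_const
  exact (measurable_fst.comp (measurable_pi_apply l)) (measurableSet_singleton i)

theorem pulls_snoc (h : History K n) (j i : Fin K) (z : ℝ) :
    pulls (h.snoc (j, z)) i = pulls h i + if j = i then 1 else 0 := by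
  simp only [pulls, Finset.card_filter]
  rw [Fin.sum_univ_castSucc]
  simp only [Fin.snoc_castSucc, Fin.snoc_last]

theorem rewardSum_snoc (h : History K n) (j i : Fin K) (z : ℝ) :
    rewardSum (h.snoc (j, z)) i = rewardSum h i + if j = i then z else 0 := by
  simp [rewardSum, Fin.sum_univ_castSucc]

theorem fullHistory_snoc (Y : Fin n → Fin K → ℝ) (I : Fin n → Fin K) (y : Fin K → ℝ)
    (i : Fin K) :
    fullHistory (Fin.snoc (α := fun _ => Fin K → ℝ) Y y) (Fin.snoc (α := fun _ => Fin K) I i) =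
      (fullHistory Y I).snoc (i, y i) := by
  funext l
  induction l using Fin.lastCases with
  | last => simp [fullHistory]
  | cast l => simp [fullHistory]

theorem pullProb_snoc (π : Policy K) (Y : Fin n → Fin K → ℝ) (I : Fin n → Fin K)
    (y : Fin K → ℝ) (i : Fin K) :
    pullProb π (Fin.snoc (α := fun _ => Fin K → ℝ) Y y) (Fin.snoc (α := fun _ => Fin K) I i) =
      pullProb π Y I * π n (fullHistory Y I) i := by
  have cast (t : Fin n) (l : Fin t) : Fin.castLE (Fin.castSucc t).isLt.le l =
      Fin.castSucc (Fin.castLE t.isLt.le l) := rfl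
  have hc (t : Fin n) : history (Fin.snoc (α := fun _ => Fin K → ℝ) Y y)
      (Fin.snoc (α := fun _ => Fin K) I i) t.castSucc = history Y I t := by
    funext l
    change Fin t at l
    simp only [history]
    rw [cast, Fin.snoc_castSucc, Fin.snoc_castSucc]
  have hl : history (Fin.snoc (α := fun _ => Fin K → ℝ) Y y)
      (Fin.snoc (α := fun _ => Fin K) I i) (Fin.last n) = fullHistory Y I := by
    funext l
    change Fin n at l
    have : Fin.castLE (Fin.last n).isLt.le l = Fin.castSucc l := rfl
    simp only [history, fullHistory]
    rw [this, Fin.snoc_castSucc, Fin.snoc_castSucc]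
  rw [pullProb, Fin.prod_univ_castSucc, pullProb]
  congr 1
  · refine Finset.prod_congr rfl fun t _ => ?_
    rw [hc, Fin.snoc_castSucc]
    rfl
  · rw [hl, Fin.snoc_last]
    rfl

theorem measurable_pullProb {π : Policy K} (hπ : IsRandomized π) (I : Fin n → Fin K) :
    Measurable fun Y : Fin n → Fin K → ℝ => pullProb π Y I :=
  Finset.measurable_prod _ fun t _ => (hπ.measurable t (I t)).comp (measurable_history I t)

theorem pullProb_nonneg {π : Policy K} (hπ : IsRandomized π) (Y : Fin n → Fin K → ℝ)
    (I : Fin n → Fin K) : 0 ≤ pullProb π Y I :=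
  Finset.prod_nonneg fun t _ => hπ.nonneg t _ _

theorem IsRandomized.le_one {π : Policy K} (hπ : IsRandomized π) (t : ℕ) (h : History K t)
    (i : Fin K) : π t h i ≤ 1 := by
  rw [← hπ.sum_eq_one t h]
  exact Finset.single_le_sum (fun j _ => hπ.nonneg t h j) (Finset.mem_univ i)

theorem pullProb_le_one {π : Policy K} (hπ : IsRandomized π) (Y : Fin n → Fin K → ℝ)
    (I : Fin n → Fin K) : pullProb π Y I ≤ 1 :=
  Finset.prod_le_one (fun t _ => hπ.nonneg t _ _) fun t _ => hπ.le_one t _ _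

theorem sum_snoc {M : Type*} [AddCommMonoid M] (F : (Fin (n + 1) → Fin K) → M) :
    ∑ I, F I = ∑ I : Fin n → Fin K, ∑ i, F (Fin.snoc (α := fun _ => Fin K) I i) := by
  rw [← (Fin.snocEquiv fun _ => Fin K).sum_comp, Fintype.sum_prod_type, Finset.sum_comm]
  rfl

theorem measurePreserving_snoc (ν : Measure (Fin K → ℝ)) [IsProbabilityMeasure ν] :
    MeasurePreserving
      (MeasurableEquiv.piFinSuccAbove (fun _ : Fin (n + 1) => Fin K → ℝ) (Fin.last n)).symm
      (ν.prod (Measure.pi fun _ : Fin n => ν)) (Measure.pi fun _ : Fin (n + 1) => ν) :=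
  (measurePreserving_piFinSuccAbove (fun _ : Fin (n + 1) => ν) (Fin.last n)).symm _

theorem piFinSuccAbove_last_symm (p : (Fin K → ℝ) × (Fin n → Fin K → ℝ)) :
    (MeasurableEquiv.piFinSuccAbove (fun _ : Fin (n + 1) => Fin K → ℝ) (Fin.last n)).symm p =
      Fin.snoc (α := fun _ => Fin K → ℝ) p.2 p.1 :=
  Fin.insertNth_last' p.1 p.2

end Basic

/-! ### Expectation over rewards and randomized pulls -/

section Expect

variable {K n : ℕ} {ν : Measure (Fin K → ℝ)} {π : Policy K}

theorem measurable_expect_integrand (hπ : IsRandomized π) {f : History K n → ℝ≥0∞}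
    (hf : Measurable f) (I : Fin n → Fin K) :
    Measurable fun Y => ENNReal.ofReal (pullProb π Y I) * f (fullHistory Y I) :=
  (measurable_pullProb hπ I).ennreal_ofReal.mul (hf.comp (measurable_fullHistory I))

theorem expect_eq_sum (hπ : IsRandomized π) {f : History K n → ℝ≥0∞} (hf : Measurable f) :
    expect ν π n f = ∑ I : Fin n → Fin K, ∫⁻ Y : Fin n → Fin K → ℝ,
      ENNReal.ofReal (pullProb π Y I) * f (fullHistory Y I) ∂(Measure.pi fun _ : Fin n => ν) :=
  lintegral_finsetSum _ fun I _ => measurable_expect_integrand hπ hf I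

theorem expect_mono {f g : History K n → ℝ≥0∞} (hfg : ∀ h, f h ≤ g h) :
    expect ν π n f ≤ expect ν π n g :=
  lintegral_mono fun _ => Finset.sum_le_sum fun _ _ => mul_le_mul_right (hfg _) _

theorem expect_add (hπ : IsRandomized π) {f g : History K n → ℝ≥0∞} (hf : Measurable f) :
    expect ν π n (fun h => f h + g h) = expect ν π n f + expect ν π n g := by
  unfold expect
  rw [← lintegral_add_left
    (Finset.measurable_sum _ fun I _ => measurable_expect_integrand hπ hf I)]
  simp only [mul_add, Finset.sum_add_distrib]

theorem expect_tsum (hπ : IsRandomized π) {f : ℕ → History K n → ℝ≥0∞}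
    (hf : ∀ s, Measurable (f s)) :
    expect ν π n (fun h => ∑' s, f s h) = ∑' s, expect ν π n (f s) := by
  unfold expect
  rw [← lintegral_tsum fun s =>
    (Finset.measurable_sum _ fun I _ => measurable_expect_integrand hπ (hf s) I).aemeasurable]
  refine lintegral_congr fun Y => ?_
  rw [Summable.tsum_finsetSum fun _ _ => ENNReal.summable]
  simp only [ENNReal.tsum_mul_left]

theorem expect_zero [IsProbabilityMeasure ν] (f : History K 0 → ℝ≥0∞) :
    expect ν π 0 f = f Fin.elim0 := by
  have hf (I : Fin 0 → Fin K) (Y) : fullHistory (K := K) (n := 0) Y I = Fin.elim0 :=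
    Subsingleton.elim _ _
  simp [expect, pullProb, hf]

/-- The tower property: given the past, the arm is drawn from the policy, and the new reward vector
is independent of both. -/
theorem expect_succ [IsProbabilityMeasure ν] (hπ : IsRandomized π)
    {f : History K (n + 1) → ℝ≥0∞} (hf : Measurable f) :
    expect ν π (n + 1) f = expect ν π n fun h =>
      ∑ i, ENNReal.ofReal (π n h i) * ∫⁻ y, f (h.snoc (i, y i)) ∂ν := by
  have hsnoc (i : Fin K) : Measurable fun p : History K n × (Fin K → ℝ) =>
      f (p.1.snoc (i, p.2 i)) := by
    have hpair : Measurable fun p : History K n × (Fin K → ℝ) => (p.1, (i, p.2 i)) :=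
      measurable_fst.prodMk (measurable_const.prodMk ((measurable_pi_apply i).comp measurable_snd))
    exact hf.comp (measurable_finSnoc.comp hpair)
  have hmeas : Measurable fun Y : Fin (n + 1) → Fin K → ℝ =>
      ∑ I : Fin (n + 1) → Fin K, ENNReal.ofReal (pullProb π Y I) * f (fullHistory Y I) :=
    Finset.measurable_sum _ fun I _ => measurable_expect_integrand hπ hf I
  unfold expect
  rw [← (measurePreserving_snoc ν).lintegral_comp hmeas]
  refine (lintegral_prod_symm' _ (hmeas.comp (MeasurableEquiv.measurable _))).trans ?_
  refine lintegral_congr fun Y => ?_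
  simp only [Function.comp_apply, piFinSuccAbove_last_symm, sum_snoc, pullProb_snoc, fullHistory_snoc]
  have hy (I : Fin n → Fin K) (i : Fin K) :
      Measurable fun y : Fin K → ℝ => f ((fullHistory Y I).snoc (i, y i)) :=
    (hsnoc i).comp (measurable_const.prodMk measurable_id)
  rw [lintegral_finsetSum _ fun I _ => Finset.measurable_sum _ fun i _ => (hy I i).const_mul _]
  refine Finset.sum_congr rfl fun I _ => ?_
  rw [lintegral_finsetSum _ fun i _ => (hy I i).const_mul _, Finset.mul_sum]
  refine Finset.sum_congr rfl fun i _ => ?_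
  rw [lintegral_const_mul _ (hy I i), ENNReal.ofReal_mul (pullProb_nonneg hπ _ _), mul_assoc]

theorem sum_ofReal_eq_one (hπ : IsRandomized π) (h : History K n) :
    ∑ i, ENNReal.ofReal (π n h i) = 1 := by
  rw [← ENNReal.ofReal_sum_of_nonneg fun i _ => hπ.nonneg n h i, hπ.sum_eq_one,
    ENNReal.ofReal_one]

theorem expect_const [IsProbabilityMeasure ν] (hπ : IsRandomized π) (n : ℕ) (c : ℝ≥0∞) :
    expect ν π n (fun _ => c) = c := by
  induction n with
  | zero => exact expect_zero _
  | succ n ih =>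
    rw [expect_succ hπ measurable_const]
    simpa [← Finset.sum_mul, sum_ofReal_eq_one hπ] using ih

end Expect

/-! ### Means over sums of independent rewards -/

/-- The expectation of `g (x + Z₁ + ⋯ + Z_s)`, where the `Z_j` are independent of law `ρ`. -/
noncomputable def iterMean (ρ : Measure ℝ) (g : ℝ → ℝ≥0∞) : ℕ → ℝ → ℝ≥0∞
  | 0 => g
  | s + 1 => fun x => ∫⁻ z, iterMean ρ g s (x + z) ∂ρ

section IterMean

variable {ρ : Measure ℝ}

theorem measurable_iterMean [SFinite ρ] {g : ℝ → ℝ≥0∞} (hg : Measurable g) (s : ℕ) :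
    Measurable (iterMean ρ g s) := by
  induction s with
  | zero => exact hg
  | succ s ih =>
    have : Measurable fun p : ℝ × ℝ => iterMean ρ g s (p.1 + p.2) := ih.comp measurable_add
    exact this.lintegral_prod_right'

theorem iterMean_mono {g g' : ℝ → ℝ≥0∞} (hg : ∀ x, g x ≤ g' x) (s : ℕ) (x : ℝ) :
    iterMean ρ g s x ≤ iterMean ρ g' s x := by
  induction s generalizing x with
  | zero => exact hg x
  | succ s ih => exact lintegral_mono fun z => ih _

theorem iterMean_tsum [SFinite ρ] {g : ℕ → ℝ → ℝ≥0∞} (hg : ∀ k, Measurable (g k)) (s : ℕ)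
    (x : ℝ) : iterMean ρ (fun x => ∑' k, g k x) s x = ∑' k, iterMean ρ (g k) s x := by
  induction s generalizing x with
  | zero => rfl
  | succ s ih =>
    simp only [iterMean, ih]
    exact lintegral_tsum fun k =>
      ((measurable_iterMean (hg k) s).comp (measurable_const_add x)).aemeasurable

theorem iterMean_add [SFinite ρ] {f g : ℝ → ℝ≥0∞} (hf : Measurable f) (s : ℕ) (x : ℝ) :
    iterMean ρ (fun x => f x + g x) s x = iterMean ρ f s x + iterMean ρ g s x := by
  induction s generalizing x with
  | zero => rfl
  | succ s ih =>
    simp only [iterMean, ih]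
    exact lintegral_add_left ((measurable_iterMean hf s).comp (measurable_const_add x)) _

theorem iterMean_const [IsProbabilityMeasure ρ] (c : ℝ≥0∞) (s : ℕ) (x : ℝ) :
    iterMean ρ (fun _ => c) s x = c := by
  induction s generalizing x with
  | zero => rfl
  | succ s ih => simp [iterMean, ih]

/-- The moment generating function is multiplicative: each additional independent reward costs a
factor of at most `exp B`. -/
theorem iterMean_exp_le (l B : ℝ)
    (hB : ∫⁻ z, ENNReal.ofReal (Real.exp (l * z)) ∂ρ ≤ ENNReal.ofReal (Real.exp B))
    (c : ℝ) (s : ℕ) (x : ℝ) :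
    iterMean ρ (fun x => ENNReal.ofReal (Real.exp (l * x + c))) s x ≤
      ENNReal.ofReal (Real.exp (l * x + c + s * B)) := by
  induction s generalizing x with
  | zero => simp [iterMean]
  | succ s ih =>
    calc iterMean ρ (fun x => ENNReal.ofReal (Real.exp (l * x + c))) (s + 1) x
        ≤ ∫⁻ z, ENNReal.ofReal (Real.exp (l * x + c + s * B)) *
            ENNReal.ofReal (Real.exp (l * z)) ∂ρ := by
          refine lintegral_mono fun z => (ih _).trans_eq ?_
          rw [← ENNReal.ofReal_mul (Real.exp_pos _).le, ← Real.exp_add]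
          ring_nf
      _ = ENNReal.ofReal (Real.exp (l * x + c + s * B)) *
            ∫⁻ z, ENNReal.ofReal (Real.exp (l * z)) ∂ρ :=
          lintegral_const_mul _ (by fun_prop)
      _ ≤ _ := by
          refine (mul_le_mul_right hB _).trans_eq ?_
          rw [← ENNReal.ofReal_mul (Real.exp_pos _).le, ← Real.exp_add]
          push_cast
          ring_nf

end IterMean

/-- The law of the rewards of arm `i`. -/
noncomputable def armLaw {K : ℕ} (ν : Measure (Fin K → ℝ)) (i : Fin K) : Measure ℝ :=
  ν.map fun y => y i

instance {K : ℕ} (ν : Measure (Fin K → ℝ)) [IsProbabilityMeasure ν] (i : Fin K) :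
    IsProbabilityMeasure (armLaw ν i) :=
  Measure.isProbabilityMeasure_map (measurable_pi_apply i).aemeasurable

/-! ### From adaptive pulls to independent samples -/

section Pulls

variable {K : ℕ} {ν : Measure (Fin K → ℝ)} [IsProbabilityMeasure ν] {π : Policy K}

/-- A conservation law replacing the usual stack of pre-drawn rewards. The second term is the
expected cost still to come if arm `i` were pulled until its cost at count `s` is paid. Only a pull
of `i` changes this potential; it either averages over a fresh reward or converts the potential into
the paid cost. -/
theorem sum_expect_pull_add_expect_iterMean (hπ : IsRandomized π) (i : Fin K) (s : ℕ)
    {g : ℝ → ℝ≥0∞} (hg : Measurable g) (n : ℕ) :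
    (∑ t ∈ Finset.range n, expect ν π t fun h => ENNReal.ofReal (π t h i) *
      (if pulls h i = s then g (rewardSum h i) else 0)) +
      expect ν π n (fun h => if pulls h i ≤ s then
        iterMean (armLaw ν i) g (s - pulls h i) (rewardSum h i) else 0) =
      iterMean (armLaw ν i) g s 0 := by
  have hmeas (t : ℕ) : Measurable fun h : History K t => if pulls h i ≤ s then
      iterMean (armLaw ν i) g (s - pulls h i) (rewardSum h i) else 0 := by
    refine Measurable.ite (measurable_pulls i (measurableSet_Iic (a := s))) ?_ measurable_const
    have : Measurable fun p : ℕ × ℝ => iterMean (armLaw ν i) g (s - p.1) p.2 :=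
      measurable_from_prod_countable_right fun k => measurable_iterMean hg (s - k)
    exact this.comp ((measurable_pulls i).prodMk (measurable_rewardSum i))
  induction n with
  | zero => simp [expect_zero, pulls, rewardSum]
  | succ n ih =>
    rw [← ih, Finset.sum_range_succ, add_assoc, expect_succ hπ (hmeas _), ← expect_add hπ]
    · congr 2
      funext h
      -- Conservation holds for each arm `j` separately, so the policy's weights matter only through
      -- their sum, which is one.
      have hstep (j : Fin K) : (if j = i then (if pulls h i = s then g (rewardSum h i) else 0)
          else 0) + ∫⁻ y, (if pulls (h.snoc (j, y j)) i ≤ s then iterMean (armLaw ν i) g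
            (s - pulls (h.snoc (j, y j)) i) (rewardSum (h.snoc (j, y j)) i) else 0) ∂ν =
          if pulls h i ≤ s then
            iterMean (armLaw ν i) g (s - pulls h i) (rewardSum h i) else 0 := by
        simp only [pulls_snoc, rewardSum_snoc]
        by_cases hj : j = i
        · subst hj
          simp only [if_true]
          rcases lt_trichotomy (pulls h j) s with hlt | heq | hgt
          · obtain ⟨d, hd⟩ : ∃ d, s - pulls h j = d + 1 := ⟨s - pulls h j - 1, by omega⟩
            have hd' : s - (pulls h j + 1) = d := by omega
            rw [if_neg hlt.ne, zero_add, hd, hd', if_pos hlt.le]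
            simp only [if_pos (Nat.succ_le_of_lt hlt), iterMean]
            have hm : Measurable fun z => iterMean (armLaw ν j) g d (rewardSum h j + z) :=
              (measurable_iterMean hg d).comp (measurable_const_add _)
            exact (lintegral_map hm (measurable_pi_apply j)).symm
          · simp [heq, iterMean]
          · have h1 : ¬ pulls h j + 1 ≤ s := by omega
            simp [hgt.ne', h1, not_le.2 hgt]
        · simp [hj]
      have hdist : ENNReal.ofReal (π n h i) * (if pulls h i = s then g (rewardSum h i) else 0) =
          ∑ j, ENNReal.ofReal (π n h j) *
            (if j = i then (if pulls h i = s then g (rewardSum h i) else 0) else 0) := by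
        simp
      rw [hdist, ← Finset.sum_add_distrib]
      simp only [← mul_add, hstep]
      rw [← Finset.sum_mul, sum_ofReal_eq_one hπ, one_mul]
    · refine (hπ.measurable n i).ennreal_ofReal.mul ?_
      exact Measurable.ite (measurable_pulls i (measurableSet_singleton s))
        (hg.comp (measurable_rewardSum i)) measurable_const

/-- Over `n` rounds, a cost that is paid at each pull of arm `i` and depends on the number of
pulls and the rewards of that arm is, in expectation, at most the cost of infinitely many pulls. -/
theorem sum_expect_pull_le (hπ : IsRandomized π) (i : Fin K) {g : ℕ → ℝ → ℝ≥0∞}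
    (hg : ∀ s, Measurable (g s)) (n : ℕ) :
    (∑ t ∈ Finset.range n, expect ν π t fun h => ENNReal.ofReal (π t h i) *
      g (pulls h i) (rewardSum h i)) ≤ ∑' s, iterMean (armLaw ν i) (g s) s 0 := by
  have hsplit (t : ℕ) : (expect ν π t fun h => ENNReal.ofReal (π t h i) *
      g (pulls h i) (rewardSum h i)) = ∑' s, expect ν π t fun h => ENNReal.ofReal (π t h i) *
        (if pulls h i = s then g s (rewardSum h i) else 0) := by
    rw [← expect_tsum hπ]
    · congr 1
      funext h
      rw [ENNReal.tsum_mul_left, tsum_eq_single (pulls h i)]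
      · simp
      · intro s hs
        simp [hs.symm]
    · intro s
      refine (hπ.measurable t i).ennreal_ofReal.mul ?_
      exact Measurable.ite (measurable_pulls i (measurableSet_singleton s))
        ((hg s).comp (measurable_rewardSum i)) measurable_const
  simp only [hsplit]
  rw [← Summable.tsum_finsetSum fun _ _ => ENNReal.summable]
  refine ENNReal.tsum_le_tsum fun s => ?_
  rw [← sum_expect_pull_add_expect_iterMean hπ i s (hg s) n]
  exact le_self_add

end Pulls

/-! ### Regret decomposition by arms -/

section Regret

variable {K n : ℕ} {ν : Measure (Fin K → ℝ)} [IsProbabilityMeasure ν] {π : Policy K}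

theorem integrable_reward (hbdd : ∀ᵐ y ∂ν, ∀ i : Fin K, y i ∈ Set.Icc (0 : ℝ) 1) (i : Fin K) :
    Integrable (fun y : Fin K → ℝ => y i) ν :=
  Integrable.of_mem_Icc 0 1 (measurable_pi_apply i).aemeasurable (hbdd.mono fun _ hy => hy i)

theorem integrable_pullProb_mul (hπ : IsRandomized π) {f : History K n → ℝ} (hf : Measurable f)
    {C : ℝ} (hC : ∀ h, |f h| ≤ C) (I : Fin n → Fin K) :
    Integrable (fun Y => pullProb π Y I * f (fullHistory Y I))
      (Measure.pi fun _ : Fin n => ν) := by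
  refine Integrable.of_bound ((measurable_pullProb hπ I).mul
    (hf.comp (measurable_fullHistory I))).aestronglyMeasurable C (Filter.Eventually.of_forall ?_)
  intro Y
  rw [Real.norm_eq_abs, abs_mul, abs_of_nonneg (pullProb_nonneg hπ Y I)]
  exact (mul_le_of_le_one_left (abs_nonneg _) (pullProb_le_one hπ Y I)).trans (hC _)

theorem integrable_pullProb_mul_sub (hπ : IsRandomized π)
    (hbdd : ∀ᵐ y ∂ν, ∀ i : Fin K, y i ∈ Set.Icc (0 : ℝ) 1) (a : Fin K) (I : Fin n → Fin K)
    (t : Fin n) :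
    Integrable (fun Y => pullProb π Y I * (Y t a - Y t (I t)))
      (Measure.pi fun _ : Fin n => ν) := by
  have hint (i : Fin K) : Integrable (fun Y : Fin n → Fin K → ℝ => Y t i)
      (Measure.pi fun _ : Fin n => ν) :=
    integrable_comp_eval (μ := fun _ : Fin n => ν) (i := t) (integrable_reward hbdd i)
  refine ((hint a).sub (hint (I t))).bdd_mul (c := 1)
    (measurable_pullProb hπ I).aestronglyMeasurable (Filter.Eventually.of_forall fun Y => ?_)
  rw [Real.norm_eq_abs, abs_of_nonneg (pullProb_nonneg hπ Y I)]
  exact pullProb_le_one hπ Y I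

theorem regret_eq_sum (hπ : IsRandomized π)
    (hbdd : ∀ᵐ y ∂ν, ∀ i : Fin K, y i ∈ Set.Icc (0 : ℝ) 1) (a : Fin K) (n : ℕ) :
    regret ν π a n = ∑ I : Fin n → Fin K, ∫ Y : Fin n → Fin K → ℝ,
      pullProb π Y I * ∑ t : Fin n, (Y t a - Y t (I t)) ∂(Measure.pi fun _ : Fin n => ν) := by
  refine integral_finsetSum _ fun I _ => ?_
  simp only [Finset.mul_sum]
  exact integrable_finsetSum _ fun t _ => integrable_pullProb_mul_sub hπ hbdd a I t

theorem toReal_expect_pull (hπ : IsRandomized π) (i : Fin K) (n : ℕ) :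
    (expect ν π n fun h => ENNReal.ofReal (π n h i)).toReal =
      ∑ I : Fin n → Fin K, ∫ Y : Fin n → Fin K → ℝ,
        pullProb π Y I * π n (fullHistory Y I) i ∂(Measure.pi fun _ : Fin n => ν) := by
  have hint (I : Fin n → Fin K) : Integrable
      (fun Y => pullProb π Y I * π n (fullHistory Y I) i) (Measure.pi fun _ : Fin n => ν) :=
    integrable_pullProb_mul hπ (hπ.measurable n i) (C := 1) (fun h => by
      rw [abs_of_nonneg (hπ.nonneg n h i)]; exact hπ.le_one n h i) I
  have hnn (I : Fin n → Fin K) (Y) : 0 ≤ pullProb π Y I * π n (fullHistory Y I) i :=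
    mul_nonneg (pullProb_nonneg hπ Y I) (hπ.nonneg _ _ _)
  have heq (I : Fin n → Fin K) : ∫⁻ Y : Fin n → Fin K → ℝ, ENNReal.ofReal (pullProb π Y I) *
      ENNReal.ofReal (π n (fullHistory Y I) i) ∂(Measure.pi fun _ : Fin n => ν) =
      ENNReal.ofReal (∫ Y : Fin n → Fin K → ℝ,
        pullProb π Y I * π n (fullHistory Y I) i ∂(Measure.pi fun _ : Fin n => ν)) := by
    rw [ofReal_integral_eq_lintegral_ofReal (hint I) (Filter.Eventually.of_forall (hnn I))]
    simp only [ENNReal.ofReal_mul (pullProb_nonneg hπ _ _)]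
  rw [expect_eq_sum hπ (hπ.measurable n i).ennreal_ofReal]
  simp only [heq]
  rw [← ENNReal.ofReal_sum_of_nonneg fun I _ => integral_nonneg (hnn I),
    ENNReal.toReal_ofReal (Finset.sum_nonneg fun I _ => integral_nonneg (hnn I))]

/-- The new reward vector is independent of the past and of the chosen arm, so the new round's
conditional regret given that arm is its gap. -/
theorem regret_succ (hπ : IsRandomized π)
    (hbdd : ∀ᵐ y ∂ν, ∀ i : Fin K, y i ∈ Set.Icc (0 : ℝ) 1) (a : Fin K) (n : ℕ) :
    regret ν π a (n + 1) = regret ν π a n + ∑ i, gap ν a i *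
      (expect ν π n fun h => ENNReal.ofReal (π n h i)).toReal := by
  have hreg (I : Fin n → Fin K) (i : Fin K) : Integrable (fun Y : Fin n → Fin K → ℝ =>
      π n (fullHistory Y I) i * (pullProb π Y I * ∑ t : Fin n, (Y t a - Y t (I t))))
      (Measure.pi fun _ : Fin n => ν) := by
    refine Integrable.bdd_mul (c := 1) ?_ ((hπ.measurable n i).comp
      (measurable_fullHistory I)).aestronglyMeasurable (Filter.Eventually.of_forall fun Y => ?_)
    · simp only [Finset.mul_sum]
      exact integrable_finsetSum _ fun t _ => integrable_pullProb_mul_sub hπ hbdd a I t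
    · rw [Real.norm_eq_abs, abs_of_nonneg (hπ.nonneg _ _ _)]
      exact hπ.le_one _ _ _
  have hstep (I : Fin n → Fin K) (i : Fin K) :
      ∫ Y : Fin (n + 1) → Fin K → ℝ, pullProb π Y (Fin.snoc (α := fun _ => Fin K) I i) *
        ∑ t, (Y t a - Y t (Fin.snoc (α := fun _ => Fin K) I i t))
        ∂(Measure.pi fun _ : Fin (n + 1) => ν) =
      (∫ Y : Fin n → Fin K → ℝ, π n (fullHistory Y I) i * (pullProb π Y I *
        ∑ t : Fin n, (Y t a - Y t (I t))) ∂(Measure.pi fun _ : Fin n => ν)) +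
      gap ν a i * ∫ Y : Fin n → Fin K → ℝ, pullProb π Y I * π n (fullHistory Y I) i
        ∂(Measure.pi fun _ : Fin n => ν) := by
    have hπi : Integrable (fun Y => pullProb π Y I * π n (fullHistory Y I) i)
        (Measure.pi fun _ : Fin n => ν) :=
      integrable_pullProb_mul hπ (hπ.measurable n i) (C := 1) (fun h => by
        rw [abs_of_nonneg (hπ.nonneg n h i)]; exact hπ.le_one n h i) I
    have hgap : Integrable (fun y : Fin K → ℝ => y a - y i) ν :=
      (integrable_reward hbdd a).sub (integrable_reward hbdd i)
    rw [← (measurePreserving_snoc ν).integral_comp']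
    simp only [piFinSuccAbove_last_symm, pullProb_snoc, Fin.sum_univ_castSucc, Fin.snoc_castSucc,
      Fin.snoc_last, mul_add]
    rw [integral_add]
    · congr 1
      · have := integral_prod_mul (μ := ν) (ν := Measure.pi fun _ : Fin n => ν) (fun _ => (1 : ℝ))
          fun Y : Fin n → Fin K → ℝ => π n (fullHistory Y I) i *
            (pullProb π Y I * ∑ t : Fin n, (Y t a - Y t (I t)))
        simp only [integral_const, probReal_univ, smul_eq_mul, one_mul] at this
        rw [← this]
        congr 1
        funext p
        ring
      · have := integral_prod_mul (μ := ν) (ν := Measure.pi fun _ : Fin n => ν)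
          (fun y => y a - y i) fun Y => pullProb π Y I * π n (fullHistory Y I) i
        rw [integral_sub (integrable_reward hbdd a) (integrable_reward hbdd i)] at this
        rw [gap, mean, mean, ← this]
        congr 1
        funext p
        ring
    · refine ((hreg I i).comp_snd ν).congr (Filter.Eventually.of_forall fun p => ?_)
      simp only
      ring
    · refine (hgap.mul_prod hπi).congr (Filter.Eventually.of_forall fun p => ?_)
      simp only
      ring
  rw [regret_eq_sum hπ hbdd, regret_eq_sum hπ hbdd, sum_snoc]
  simp only [hstep, Finset.sum_add_distrib, toReal_expect_pull hπ]
  congr 1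
  · refine Finset.sum_congr rfl fun I _ => ?_
    rw [← integral_finsetSum]
    · simp only [← Finset.sum_mul, hπ.sum_eq_one, one_mul]
    · exact fun i _ => hreg I i
  · rw [Finset.sum_comm]
    simp only [Finset.mul_sum]

/-- The expected number of pulls of arm `i` in the first `n` rounds. -/
noncomputable def expectedPulls (ν : Measure (Fin K → ℝ)) (π : Policy K) (n : ℕ) (i : Fin K) :
    ℝ≥0∞ :=
  ∑ t ∈ Finset.range n, expect ν π t fun h => ENNReal.ofReal (π t h i)

theorem expect_pull_le_one (hπ : IsRandomized π) (i : Fin K) (n : ℕ) :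
    (expect ν π n fun h => ENNReal.ofReal (π n h i)) ≤ 1 := by
  rw [← expect_const (ν := ν) hπ n 1]
  exact expect_mono fun h => ENNReal.ofReal_le_one.2 (hπ.le_one n h i)

theorem expectedPulls_le (hπ : IsRandomized π) (i : Fin K) (n : ℕ) :
    expectedPulls ν π n i ≤ n := by
  refine (Finset.sum_le_sum fun t _ => expect_pull_le_one hπ i t).trans ?_
  simp

theorem regret_eq_sum_gap_mul (hπ : IsRandomized π)
    (hbdd : ∀ᵐ y ∂ν, ∀ i : Fin K, y i ∈ Set.Icc (0 : ℝ) 1) (a : Fin K) (n : ℕ) :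
    regret ν π a n = ∑ i, gap ν a i * (expectedPulls ν π n i).toReal := by
  induction n with
  | zero => simp [regret, expectedPulls]
  | succ n ih =>
    rw [regret_succ hπ hbdd, ih, ← Finset.sum_add_distrib]
    refine Finset.sum_congr rfl fun i _ => ?_
    rw [← mul_add, expectedPulls, expectedPulls, Finset.sum_range_succ, ENNReal.toReal_add]
    · exact ((expectedPulls_le hπ i n).trans_lt (ENNReal.natCast_lt_top n)).ne
    · exact ((expect_pull_le_one hπ i n).trans_lt ENNReal.one_lt_top).ne

end Regret

/-! ### Hoeffding bounds and exponential costs -/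

section Concentration

/-- A geometric series, with `exp (-x) ≤ 1 / (1 + x)` bounding its ratio. -/
theorem tsum_ofReal_exp_neg_mul_le {x : ℝ} (hx : 0 < x) :
    ∑' k : ℕ, ENNReal.ofReal (Real.exp (-(k * x))) ≤ ENNReal.ofReal (1 + 1 / x) := by
  have hlt : Real.exp (-x) < 1 := by simpa using hx
  have hpow (k : ℕ) : Real.exp (-(k * x)) = Real.exp (-x) ^ k := by
    rw [← Real.exp_nat_mul]
    ring_nf
  simp only [hpow]
  rw [← ENNReal.ofReal_tsum_of_nonneg (fun k => by positivity)
    (summable_geometric_of_lt_one (Real.exp_pos _).le hlt),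
    tsum_geometric_of_lt_one (Real.exp_pos _).le hlt]
  refine ENNReal.ofReal_le_ofReal ?_
  have hle : Real.exp (-x) ≤ 1 / (1 + x) := by
    rw [Real.exp_neg, ← one_div]
    exact one_div_le_one_div_of_le (by linarith) (by linarith [Real.add_one_le_exp x])
  have hpos : 0 < x / (1 + x) := by positivity
  calc (1 - Real.exp (-x))⁻¹ ≤ (x / (1 + x))⁻¹ := by
        refine inv_anti₀ hpos ?_
        have : x / (1 + x) = 1 - 1 / (1 + x) := by field_simp; ring
        linarith
    _ = 1 + 1 / x := by field_simp; ring

variable {K : ℕ} {ν : Measure (Fin K → ℝ)} [IsProbabilityMeasure ν]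

/-- Hoeffding's lemma for a variable in an interval of length one. -/
theorem lintegral_exp_mul_armLaw_le (hbdd : ∀ᵐ y ∂ν, ∀ i : Fin K, y i ∈ Set.Icc (0 : ℝ) 1)
    (i : Fin K) (l : ℝ) :
    ∫⁻ z, ENNReal.ofReal (Real.exp (l * z)) ∂(armLaw ν i) ≤
      ENNReal.ofReal (Real.exp (l * mean ν i + l ^ 2 / 8)) := by
  have hsub := ProbabilityTheory.hasSubgaussianMGF_of_mem_Icc (μ := ν) (a := 0) (b := 1)
    (X := fun y : Fin K → ℝ => y i) (measurable_pi_apply i).aemeasurable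
    (hbdd.mono fun _ hy => hy i)
  have hle := hsub.mgf_le l
  rw [ProbabilityTheory.mgf] at hle
  rw [armLaw, lintegral_map (by fun_prop) (measurable_pi_apply i)]
  have hint := hsub.integrable_exp_mul l
  have hsplit (y : Fin K → ℝ) : ENNReal.ofReal (Real.exp (l * y i)) =
      ENNReal.ofReal (Real.exp (l * mean ν i)) *
        ENNReal.ofReal (Real.exp (l * (y i - ∫ y, y i ∂ν))) := by
    rw [← ENNReal.ofReal_mul (Real.exp_pos _).le, ← Real.exp_add, mean]
    ring_nf
  rw [lintegral_congr hsplit, lintegral_const_mul _ (by fun_prop), ← ofReal_integral_eq_lintegral_ofReal hint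
    (Filter.Eventually.of_forall fun _ => (Real.exp_pos _).le),
    ← ENNReal.ofReal_mul (Real.exp_pos _).le, Real.exp_add]
  refine ENNReal.ofReal_le_ofReal (mul_le_mul_of_nonneg_left (hle.trans_eq ?_)
    (Real.exp_pos _).le)
  congr 1
  norm_num
  ring

theorem iterMean_armLaw_exp_le (hbdd : ∀ᵐ y ∂ν, ∀ i : Fin K, y i ∈ Set.Icc (0 : ℝ) 1)
    (i : Fin K) (l c : ℝ) (s : ℕ) :
    iterMean (armLaw ν i) (fun x => ENNReal.ofReal (Real.exp (l * x + c))) s 0 ≤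
      ENNReal.ofReal (Real.exp (c + s * (l * mean ν i + l ^ 2 / 8))) := by
  simpa using iterMean_exp_le l _ (lintegral_exp_mul_armLaw_le hbdd i l) c s 0

/-- The indicator that `s` rewards of sum `x` have an average above `b`. -/
noncomputable def overshoot (b : ℝ) (s : ℕ) (x : ℝ) : ℝ≥0∞ := if s * b < x then 1 else 0

/-- If `s` rewards of sum `x` have an average of at most `a`, the exponential of a quarter of `s`
times the squared difference. -/
noncomputable def undershootCost (a : ℝ) (s : ℕ) (x : ℝ) : ℝ≥0∞ :=
  if x ≤ s * a then ENNReal.ofReal (Real.exp ((s * a - x) ^ 2 / (4 * s))) else 0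

theorem measurable_overshoot (b : ℝ) (s : ℕ) : Measurable (overshoot b s) :=
  Measurable.ite measurableSet_Ioi measurable_const measurable_const

theorem measurable_undershootCost (a : ℝ) (s : ℕ) : Measurable (undershootCost a s) :=
  Measurable.ite measurableSet_Iic (by fun_prop) measurable_const

/-- Chernoff's bound at the optimal tilt `d`: the exponent per sample is `d ^ 2 / 8 - d ^ 2 / 4`. -/
theorem iterMean_overshoot_le (hbdd : ∀ᵐ y ∂ν, ∀ i : Fin K, y i ∈ Set.Icc (0 : ℝ) 1)
    (i : Fin K) {d : ℝ} (hd : 0 < d) (s : ℕ) :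
    iterMean (armLaw ν i) (overshoot (mean ν i + d / 4) s) s 0 ≤
      ENNReal.ofReal (Real.exp (-(s * (d ^ 2 / 8)))) := by
  refine (iterMean_mono (g' := fun x => ENNReal.ofReal
    (Real.exp (d * x + -(d * (s * (mean ν i + d / 4)))))) (fun x => ?_) s 0).trans
    ((iterMean_armLaw_exp_le hbdd i _ _ s).trans_eq ?_)
  · rw [overshoot]
    split_ifs with hx
    · rw [ENNReal.one_le_ofReal]
      exact Real.one_le_exp (by nlinarith)
    · exact zero_le
  · ring_nf

/-- Slice the normalized deficit `y = (s a - x) / √s` into unit intervals. On `[k, k + 1)` the cost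
is at most `exp ((k + 1) ^ 2 / 4)`, and the indicator of `y ≥ k` is at most `exp (l k * (y - k))`.
The tilts `l k` are left free for each slice. -/
theorem undershootCost_le_tsum {a r : ℝ} {s : ℕ} (hr : r = Real.sqrt s) {l : ℕ → ℝ}
    (hl : ∀ k, 0 ≤ l k) (x : ℝ) :
    undershootCost a s x ≤ ∑' k : ℕ, ENNReal.ofReal
      (Real.exp (-(l k / r) * x + (((k : ℝ) + 1) ^ 2 / 4 + l k * (r * a - k)))) := by
  rw [undershootCost]
  split_ifs with hx
  · have hr0 : 0 ≤ r := hr ▸ Real.sqrt_nonneg _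
    have hrs : r * r = s := hr ▸ Real.mul_self_sqrt (Nat.cast_nonneg s)
    set y := (s * a - x) / r with hy
    have hy0 : 0 ≤ y := div_nonneg (by linarith) hr0
    have hysq : (s * a - x) ^ 2 / (4 * s) = y ^ 2 / 4 := by
      rw [hy, div_pow, ← hrs, ← sq]
      ring
    have hylin : y = r * a - x / r := by
      rw [hy, sub_div, ← hrs, mul_right_comm, mul_assoc, mul_div_assoc, mul_div_assoc]
      rcases eq_or_ne r 0 with h | h
      · simp [h]
      · field_simp
    refine le_trans (ENNReal.ofReal_le_ofReal (Real.exp_le_exp.2 ?_)) (ENNReal.le_tsum ⌊y⌋₊)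
    have h1 := Nat.floor_le hy0
    have h2 := (Nat.lt_floor_add_one y).le
    have h3 : l ⌊y⌋₊ * (y - ⌊y⌋₊) ≥ 0 := mul_nonneg (hl _) (by linarith)
    have h4 : y ^ 2 ≤ ((⌊y⌋₊ : ℝ) + 1) ^ 2 := pow_le_pow_left₀ hy0 h2 2
    have h5 : -(l ⌊y⌋₊ / r) * x + l ⌊y⌋₊ * (r * a - ⌊y⌋₊) = l ⌊y⌋₊ * (y - ⌊y⌋₊) := by
      rw [hylin]
      ring
    rw [hysq]
    linarith
  · exact zero_le

/-- Slice `k` has probability at most `exp (-2 (k + √s d / 4) ^ 2)`, which beats its cost `exp ((k +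
1) ^ 2 / 4)`. The cross term of the square is discarded. -/
theorem iterMean_undershootCost_le (hbdd : ∀ᵐ y ∂ν, ∀ i : Fin K, y i ∈ Set.Icc (0 : ℝ) 1)
    (i : Fin K) {d : ℝ} (hd : 0 < d) (s : ℕ) :
    iterMean (armLaw ν i) (undershootCost (mean ν i - d / 4) s) s 0 ≤
      3 * ENNReal.ofReal (Real.exp (-(s * (d ^ 2 / 8)))) := by
  obtain ⟨r, hr⟩ : ∃ r, r = Real.sqrt s := ⟨_, rfl⟩
  have hr0 : 0 ≤ r := hr ▸ Real.sqrt_nonneg _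
  have hrs : r * r = s := hr ▸ Real.mul_self_sqrt (Nat.cast_nonneg s)
  -- This tilt minimizes `l ^ 2 / 8 - l * (k + r * d / 4)`.
  refine (iterMean_mono (undershootCost_le_tsum hr (l := fun k => 4 * (k + r * d / 4))
    fun k => by positivity) s 0).trans ?_
  rw [iterMean_tsum (fun k => by fun_prop)]
  have hterm (k : ℕ) : iterMean (armLaw ν i) (fun x => ENNReal.ofReal
      (Real.exp (-(4 * (k + r * d / 4) / r) * x +
        (((k : ℝ) + 1) ^ 2 / 4 + 4 * (k + r * d / 4) * (r * (mean ν i - d / 4) - k))))) s 0 ≤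
      ENNReal.ofReal (Real.exp (1 / 4 - s * (d ^ 2 / 8))) *
        ENNReal.ofReal (Real.exp (-(k * 1))) := by
    refine (iterMean_armLaw_exp_le hbdd i _ _ s).trans ?_
    rw [← ENNReal.ofReal_mul (Real.exp_pos _).le, ← Real.exp_add]
    refine ENNReal.ofReal_le_ofReal (Real.exp_le_exp.2 ?_)
    obtain ⟨l, hl⟩ : ∃ l, l = 4 * (k + r * d / 4) := ⟨_, rfl⟩
    have hlin : s * (-(l / r) * mean ν i) = -(l * r * mean ν i) := by
      rw [← hrs]
      rcases hr0.eq_or_lt with h | h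
      · simp [← h]
      · field_simp
    -- Equality when `s > 0`; for `s = 0`, division by zero makes the left side vanish.
    have hsq : s * ((-(l / r)) ^ 2 / 8) ≤ l ^ 2 / 8 := by
      rw [← hrs]
      rcases hr0.eq_or_lt with h | h
      · rw [← h]
        simp only [mul_zero, zero_mul]
        positivity
      · apply le_of_eq
        field_simp
    -- Thus `(k + 1) ^ 2 / 4 - 2 k ^ 2 ≤ 1 / 4 - k`, leaving a geometric series in `k`.
    have hk : (k : ℝ) ≤ (k : ℝ) ^ 2 := by exact_mod_cast Nat.le_self_pow two_ne_zero k
    have hkr : 0 ≤ (k : ℝ) * r * d := by positivity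
    rw [← hl, mul_add (s : ℝ), hlin]
    have hexp : l * (r * (mean ν i - d / 4) - k) - l * r * mean ν i = - l ^ 2 / 4 := by
      rw [hl]
      ring
    have hl2 : l ^ 2 / 8 = 2 * (k : ℝ) ^ 2 + k * r * d + s * (d ^ 2 / 8) := by
      rw [hl, ← hrs]
      ring
    nlinarith
  refine (ENNReal.tsum_le_tsum hterm).trans ?_
  rw [ENNReal.tsum_mul_left]
  -- The series sums to at most `2`, so the factor `3` comes from `2 exp (1 / 4) ≤ 3`.
  have he : Real.exp (1 / 4) ≤ 3 / 2 := by
    have h4 : Real.exp (1 / 4) ^ 4 = Real.exp 1 := by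
      rw [← Real.exp_nat_mul]
      norm_num
    refine le_of_pow_le_pow_left₀ (n := 4) (by norm_num) (by norm_num) ?_
    rw [h4]
    exact Real.exp_one_lt_d9.le.trans (by norm_num)
  calc _ ≤ ENNReal.ofReal (Real.exp (1 / 4 - s * (d ^ 2 / 8))) * ENNReal.ofReal (1 + 1 / 1) :=
        mul_le_mul_right (tsum_ofReal_exp_neg_mul_le one_pos) _
    _ = ENNReal.ofReal (Real.exp (1 / 4) * 2 * Real.exp (-(s * (d ^ 2 / 8)))) := by
        rw [← ENNReal.ofReal_mul (Real.exp_pos _).le, sub_eq_add_neg, Real.exp_add]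
        ring_nf
    _ ≤ ENNReal.ofReal (3 * Real.exp (-(s * (d ^ 2 / 8)))) := by
        refine ENNReal.ofReal_le_ofReal (mul_le_mul_of_nonneg_right ?_ (Real.exp_pos _).le)
        linarith
    _ = _ := by
        rw [ENNReal.ofReal_mul (by norm_num)]
        norm_num

end Concentration

/-! ### The SoftElim policy and its one-round bound -/

section SoftElim

variable {K : ℕ}

theorem sq_sqrt_eight : Real.sqrt 8 ^ 2 = 8 := Real.sq_sqrt (by norm_num)

theorem pulls_mul_empMean {t : ℕ} (h : History K t) (i : Fin K) :
    (pulls h i : ℝ) * empMean h i = rewardSum h i := by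
  change (pulls h i : ℝ) * (rewardSum h i / pulls h i) = rewardSum h i
  refine mul_div_cancel_of_imp' fun h0 => ?_
  rw [Nat.cast_eq_zero, pulls, Finset.card_eq_zero, Finset.filter_eq_empty_iff] at h0
  exact Finset.sum_eq_zero fun l hl => if_neg (h0 hl)

theorem measurable_score {t : ℕ} (i : Fin K) : Measurable fun h : History K t => score h i := by
  have hp (j : Fin K) : Measurable fun h : History K t => (pulls h j : ℝ) :=
    measurable_from_top.comp (measurable_pulls j)
  have he (j : Fin K) : Measurable fun h : History K t => empMean h j :=
    (measurable_rewardSum j).div (hp j)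
  exact ((((Measurable.iSup he).sub (he i)).pow_const 2).const_mul 2).mul (hp i)

theorem isRandomized_softElim [NeZero K] (σ : Equiv.Perm (Fin K)) (w : ℝ) :
    IsRandomized (softElim σ w) where
  measurable t i := by
    unfold softElim
    by_cases ht : t < K
    · simp only [ht, dite_true]
      exact measurable_const
    · simp only [ht, dite_false]
      have he (j : Fin K) : Measurable fun h : History K t => Real.exp (-score h j / w ^ 2) :=
        ((measurable_score j).neg.div_const _).exp
      exact (he i).div (Finset.measurable_sum _ fun j _ => he j)
  nonneg t h i := by
    unfold softElim
    split_ifs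
    · exact zero_le_one
    · exact le_rfl
    · positivity
  sum_eq_one t h := by
    unfold softElim
    split_ifs with ht
    · simp
    · rw [← Finset.sum_div]
      exact div_self (Finset.sum_pos (fun j _ => Real.exp_pos _) Finset.univ_nonempty).ne'

variable {t : ℕ} {σ : Equiv.Perm (Fin K)}

theorem score_nonneg (h : History K t) (i : Fin K) : 0 ≤ score h i := by
  unfold score
  positivity

/-- An empirically best arm has score zero, so the normalizing sum is at least one. -/
theorem softElim_le_exp_neg_score [NeZero K] (w : ℝ) (ht : ¬ t < K) (h : History K t)
    (i : Fin K) : softElim σ w t h i ≤ Real.exp (-score h i / w ^ 2) := by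
  obtain ⟨j, hj⟩ := exists_eq_ciSup_of_finite (f := fun j : Fin K => empMean h j)
  have hscore : score h j = 0 := by simp [score, ← hj]
  simp only [softElim, ht, dite_false]
  refine div_le_self (Real.exp_pos _).le ?_
  calc (1 : ℝ) = Real.exp (-score h j / w ^ 2) := by simp [hscore]
    _ ≤ _ := Finset.single_le_sum (f := fun j => Real.exp (-score h j / w ^ 2))
      (fun _ _ => (Real.exp_pos _).le) (Finset.mem_univ j)

/-- The normalizing sum cancels in the ratio of two pull probabilities, and the score of `i` is
nonnegative. This charges pulls of `i` to pulls of `j`. -/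
theorem softElim_le_mul_exp_score (w : ℝ) (ht : ¬ t < K) (h : History K t) (i j : Fin K) :
    softElim σ w t h i ≤ softElim σ w t h j * Real.exp (score h j / w ^ 2) := by
  simp only [softElim, ht, dite_false]
  rw [div_mul_eq_mul_div, ← Real.exp_add, neg_div (w ^ 2) (score h j), neg_add_cancel,
    Real.exp_zero]
  gcongr
  exact Real.exp_le_one_iff.2
    (div_nonpos_of_nonpos_of_nonneg (neg_nonpos.2 (score_nonneg h i)) (sq_nonneg w))

/-- Apart from the initial pull, a suboptimal arm `i` is pulled with probability at most `1 / n`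
unless it has fewer than `N` pulls, or its average is above `b`, or the average of the arm `j` is
at most `a`. -/
theorem softElim_le [NeZero K] {a b : ℝ} (hab : b < a) {n N : ℕ}
    (hN : ∀ T : ℕ, N ≤ T → Real.exp (-((a - b) ^ 2 * T / 4)) ≤ 1 / n) (hN0 : 0 < N)
    (i j : Fin K) (t : ℕ) (h : History K t) :
    ENNReal.ofReal (softElim σ (Real.sqrt 8) t h i) ≤
      (if (σ.symm i : ℕ) = t then 1 else 0) + ENNReal.ofReal (1 / n) +
      ENNReal.ofReal (softElim σ (Real.sqrt 8) t h i) *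
        ((if pulls h i < N then 1 else 0) + overshoot b (pulls h i) (rewardSum h i)) +
      ENNReal.ofReal (softElim σ (Real.sqrt 8) t h j) *
        undershootCost a (pulls h j) (rewardSum h j) := by
  by_cases ht : t < K
  · refine le_trans ?_ (le_self_add.trans (le_self_add.trans le_self_add))
    simp only [softElim, ht, dite_true]
    by_cases hi : i = σ ⟨t, ht⟩
    · simp [hi]
    · simp [hi]
  by_cases hT : pulls h i < N
  · refine le_trans ?_ (le_add_right le_add_self)
    simp only [hT, if_true]
    exact (mul_one _).symm.le.trans (mul_le_mul_right le_self_add _)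
  by_cases hS : pulls h i * b < rewardSum h i
  · refine le_trans ?_ (le_add_right le_add_self)
    simp only [overshoot, hS, if_true]
    exact (mul_one _).symm.le.trans (mul_le_mul_right le_add_self _)
  rw [not_lt] at hT hS
  have hTpos : (0 : ℝ) < pulls h i := by exact_mod_cast hN0.trans_le hT
  have hib : empMean h i ≤ b := by
    change rewardSum h i / pulls h i ≤ b
    rw [div_le_iff₀ hTpos]
    linarith
  -- Any arm may attain the maximum. If it reaches `a`, the empirical gap of `i` is at least `a -
  -- b`; otherwise `j` also averages below `a`, and its empirical gap is at most its deficit from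
  -- `a`.
  by_cases hM : a ≤ ⨆ k, empMean h k
  · refine le_trans ?_ (le_self_add.trans' (le_self_add.trans' le_add_self))
    refine ENNReal.ofReal_le_ofReal ((softElim_le_exp_neg_score _ ht h i).trans
      (le_trans (Real.exp_le_exp.2 ?_) (hN _ hT)))
    rw [sq_sqrt_eight, score]
    have hsq : (a - b) ^ 2 ≤ ((⨆ k, empMean h k) - empMean h i) ^ 2 :=
      pow_le_pow_left₀ (by linarith) (by linarith) 2
    nlinarith [mul_le_mul_of_nonneg_right hsq hTpos.le]
  · refine le_trans ?_ le_add_self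
    rw [not_le] at hM
    have hle : empMean h j ≤ ⨆ k, empMean h k :=
      le_ciSup (f := fun k => empMean h k) (Set.finite_range _).bddAbove j
    have hlin := pulls_mul_empMean h j
    have hund : rewardSum h j ≤ pulls h j * a := by
      rw [← hlin]
      exact mul_le_mul_of_nonneg_left (hle.trans hM.le) (Nat.cast_nonneg _)
    rw [undershootCost, if_pos hund, ← ENNReal.ofReal_mul ((isRandomized_softElim σ _).nonneg _ _ _)]
    refine ENNReal.ofReal_le_ofReal ((softElim_le_mul_exp_score _ ht h i j).trans
      (mul_le_mul_of_nonneg_left (Real.exp_le_exp.2 ?_)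
        ((isRandomized_softElim σ _).nonneg _ _ _)))
    have hsq : ((⨆ k, empMean h k) - empMean h j) ^ 2 ≤ (a - empMean h j) ^ 2 :=
      pow_le_pow_left₀ (by linarith) (by linarith) 2
    have heq : (pulls h j * a - rewardSum h j) ^ 2 / (4 * pulls h j) =
        (a - empMean h j) ^ 2 * pulls h j / 4 := by
      rw [← hlin, ← mul_sub, mul_pow, sq (pulls h j : ℝ), mul_comm 4, ← div_div]
      rcases eq_or_ne (pulls h j : ℝ) 0 with h0 | h0
      · simp [h0]
      · field_simp
    rw [sq_sqrt_eight, score, heq]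
    nlinarith [mul_le_mul_of_nonneg_right hsq (Nat.cast_nonneg (α := ℝ) (pulls h j))]

end SoftElim

/-! ### Expected pulls of a suboptimal arm and the regret bound -/

theorem gap_self {K : ℕ} (ν : Measure (Fin K → ℝ)) (a : Fin K) : gap ν a a = 0 := sub_self _

variable {K : ℕ} {ν : Measure (Fin K → ℝ)} [IsProbabilityMeasure ν]

theorem tsum_iterMean_overshoot_le (hbdd : ∀ᵐ y ∂ν, ∀ i : Fin K, y i ∈ Set.Icc (0 : ℝ) 1)
    (i : Fin K) {d : ℝ} (hd : 0 < d) :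
    ∑' s, iterMean (armLaw ν i) (overshoot (mean ν i + d / 4) s) s 0 ≤
      ENNReal.ofReal (1 + 8 / d ^ 2) := by
  refine (ENNReal.tsum_le_tsum fun s => iterMean_overshoot_le hbdd i hd s).trans
    ((tsum_ofReal_exp_neg_mul_le (by positivity)).trans_eq ?_)
  rw [one_div_div]

theorem tsum_iterMean_undershootCost_le
    (hbdd : ∀ᵐ y ∂ν, ∀ i : Fin K, y i ∈ Set.Icc (0 : ℝ) 1) (i : Fin K) {d : ℝ} (hd : 0 < d) :
    ∑' s, iterMean (armLaw ν i) (undershootCost (mean ν i - d / 4) s) s 0 ≤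
      ENNReal.ofReal (3 * (1 + 8 / d ^ 2)) := by
  refine (ENNReal.tsum_le_tsum fun s => iterMean_undershootCost_le hbdd i hd s).trans ?_
  rw [ENNReal.tsum_mul_left, ENNReal.ofReal_mul (by norm_num), ENNReal.ofReal_ofNat,
    ← one_div_div (d ^ 2)]
  exact mul_le_mul_right (tsum_ofReal_exp_neg_mul_le (by positivity)) _

theorem tsum_iterMean_ite_lt (i : Fin K) (N : ℕ) :
    ∑' s, iterMean (armLaw ν i) (fun _ => if s < N then 1 else 0) s 0 = (N : ℝ≥0∞) := by
  simp only [iterMean_const]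
  rw [tsum_eq_sum (s := Finset.range N) fun s hs => if_neg (by simpa using hs)]
  rw [Finset.sum_congr rfl fun s hs => if_pos (Finset.mem_range.1 hs)]
  simp

/-- The total is `1` for the initial pull, `1` for `n` rounds at `1 / n`, `m + 1` for the early
pulls, `1 + 8 / d ^ 2` for overshoots and three times that for undershoots. -/
theorem expectedPulls_softElim_le [NeZero K]
    (hbdd : ∀ᵐ y ∂ν, ∀ i : Fin K, y i ∈ Set.Icc (0 : ℝ) 1) (σ : Equiv.Perm (Fin K))
    {a i : Fin K} (hgap : 0 < gap ν a i) {n : ℕ} (hn : 2 ≤ n) :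
    expectedPulls ν (softElim σ (Real.sqrt 8)) n i ≤
      ENNReal.ofReal (7 + 16 * Real.log n / gap ν a i ^ 2 + 32 / gap ν a i ^ 2) := by
  set d := gap ν a i with hd
  set π := softElim σ (Real.sqrt 8)
  have hπ : IsRandomized π := isRandomized_softElim σ _
  have hn0 : (0 : ℝ) < n := by positivity
  have hlog : 0 < Real.log n := Real.log_pos (by exact_mod_cast hn)
  set m := 16 * Real.log n / d ^ 2 with hm
  have hm0 : 0 < m := by positivity
  set N := ⌈m⌉₊
  have hab : mean ν i + d / 4 < mean ν a - d / 4 := by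
    rw [gap] at hd
    linarith
  have hdiff : mean ν a - d / 4 - (mean ν i + d / 4) = d / 2 := by
    rw [gap] at hd
    linarith
  -- Since `a - b = d / 2`, the exponent is `-d ^ 2 T / 16`, which dictates the `16` in `m`.
  have hN (T : ℕ) (hT : N ≤ T) :
      Real.exp (-((mean ν a - d / 4 - (mean ν i + d / 4)) ^ 2 * T / 4)) ≤ 1 / n := by
    have hmT : m ≤ T := (Nat.le_ceil m).trans (by exact_mod_cast hT)
    rw [hdiff, one_div, ← Real.exp_log hn0, ← Real.exp_neg, Real.exp_le_exp]
    rw [hm, div_le_iff₀ (by positivity)] at hmT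
    linarith
  let G : ℕ → ℝ → ℝ≥0∞ := fun s x => (if s < N then 1 else 0) + overshoot (mean ν i + d / 4) s x
  have hG (s : ℕ) : Measurable (G s) := measurable_const.add (measurable_overshoot _ s)
  have hcost {g : ℕ → ℝ → ℝ≥0∞} (hg : ∀ s, Measurable (g s)) (j : Fin K) (t : ℕ) :
      Measurable fun h : History K t => ENNReal.ofReal (π t h j) *
        g (pulls h j) (rewardSum h j) := by
    have : Measurable fun p : ℕ × ℝ => g p.1 p.2 := measurable_from_prod_countable_right hg
    exact (hπ.measurable t j).ennreal_ofReal.mul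
      (this.comp ((measurable_pulls j).prodMk (measurable_rewardSum j)))
  have hround (t : ℕ) : (expect ν π t fun h => ENNReal.ofReal (π t h i)) ≤
      (if (σ.symm i : ℕ) = t then 1 else 0) + ENNReal.ofReal (1 / n) +
      (expect ν π t fun h => ENNReal.ofReal (π t h i) * G (pulls h i) (rewardSum h i)) +
      expect ν π t fun h => ENNReal.ofReal (π t h a) *
        undershootCost (mean ν a - d / 4) (pulls h a) (rewardSum h a) := by
    refine (expect_mono fun h =>
      softElim_le hab hN (Nat.ceil_pos.2 hm0) i a t h).trans_eq ?_
    refine (expect_add (f := fun h => (if (σ.symm i : ℕ) = t then 1 else 0) +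
      ENNReal.ofReal (1 / n) + ENNReal.ofReal (π t h i) * G (pulls h i) (rewardSum h i)) hπ
      (measurable_const.add (hcost hG i t))).trans ?_
    rw [expect_add hπ measurable_const, expect_const hπ]
  have hsum := Finset.sum_le_sum fun t (_ : t ∈ Finset.range n) => hround t
  simp only [Finset.sum_add_distrib] at hsum
  have hinit : ∑ t ∈ Finset.range n, (if (σ.symm i : ℕ) = t then (1 : ℝ≥0∞) else 0) ≤ 1 := by
    rw [Finset.sum_ite_eq]
    split_ifs
    · exact le_rfl
    · exact zero_le
  have hunif : ∑ t ∈ Finset.range n, ENNReal.ofReal (1 / n) = 1 := by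
    rw [Finset.sum_const, Finset.card_range, nsmul_eq_mul, ← ENNReal.ofReal_natCast,
      ← ENNReal.ofReal_mul hn0.le, mul_one_div_cancel hn0.ne', ENNReal.ofReal_one]
  have hGsum : ∑ t ∈ Finset.range n, (expect ν π t fun h => ENNReal.ofReal (π t h i) *
      G (pulls h i) (rewardSum h i)) ≤ ENNReal.ofReal (m + 1) + ENNReal.ofReal (1 + 8 / d ^ 2) := by
    refine (sum_expect_pull_le hπ i hG n).trans ?_
    have hadd (s : ℕ) : iterMean (armLaw ν i) (G s) s 0 =
        iterMean (armLaw ν i) (fun _ => if s < N then 1 else 0) s 0 +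
          iterMean (armLaw ν i) (overshoot (mean ν i + d / 4) s) s 0 :=
      iterMean_add measurable_const s 0
    simp only [hadd]
    rw [ENNReal.tsum_add, tsum_iterMean_ite_lt]
    refine add_le_add ?_ (tsum_iterMean_overshoot_le hbdd i hgap)
    rw [← ENNReal.ofReal_natCast]
    exact ENNReal.ofReal_le_ofReal (Nat.ceil_lt_add_one hm0.le).le
  have hUsum := (sum_expect_pull_le hπ a (fun s => measurable_undershootCost
    (mean ν a - d / 4) s) n).trans (tsum_iterMean_undershootCost_le hbdd a hgap)
  refine hsum.trans ((add_le_add (add_le_add (add_le_add hinit hunif.le) hGsum) hUsum).trans_eq ?_)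
  rw [← ENNReal.ofReal_one, ← ENNReal.ofReal_add (by positivity) (by positivity),
    ← ENNReal.ofReal_add (by positivity) (by positivity),
    ← ENNReal.ofReal_add (by positivity) (by positivity),
    ← ENNReal.ofReal_add (by positivity) (by positivity)]
  congr 1
  ring

theorem gap_mul_expectedPulls_softElim_le [NeZero K]
    (hbdd : ∀ᵐ y ∂ν, ∀ i : Fin K, y i ∈ Set.Icc (0 : ℝ) 1) (σ : Equiv.Perm (Fin K))
    {a i : Fin K} (hgap : 0 < gap ν a i) (n : ℕ) :
    gap ν a i * (expectedPulls ν (softElim σ (Real.sqrt 8)) n i).toReal ≤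
      (2 * Real.exp 1 + 1) * (16 / gap ν a i * Real.log n + gap ν a i) + 5 * gap ν a i := by
  have he := Real.exp_one_gt_d9
  -- For `n < 2` the logarithm is zero (with `log 0 = 0`) and at most one pull occurs, which the
  -- multiples of the gap cover.
  rcases Nat.lt_or_ge n 2 with hn | hn
  · have hle : (expectedPulls ν (softElim σ (Real.sqrt 8)) n i).toReal ≤ 1 := by
      refine ENNReal.toReal_le_of_le_ofReal zero_le_one
        ((expectedPulls_le (isRandomized_softElim σ _) i n).trans ?_)
      rw [ENNReal.ofReal_one]
      exact_mod_cast Nat.le_of_lt_succ hn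
    have hlog : Real.log n = 0 := by interval_cases n <;> simp
    rw [hlog]
    nlinarith
  · have hle := ENNReal.toReal_le_of_le_ofReal (by positivity)
      (expectedPulls_softElim_le hbdd σ hgap hn)
    set d := gap ν a i
    have hlog : (0.69 : ℝ) ≤ Real.log n :=
      le_trans (by linarith [Real.log_two_gt_d9])
        (Real.log_le_log two_pos (by exact_mod_cast hn))
    -- This absorbs the constant `32 / d` into the term `32 e log n / d` of the target; the
    -- remaining `7 d` fits since `7 ≤ 2 e + 6`.
    have hmul : 1 ≤ Real.exp 1 * Real.log n := by nlinarith
    have hinv : 1 / d ≤ Real.exp 1 * Real.log n / d :=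
      div_le_div_of_nonneg_right hmul hgap.le
    calc d * (expectedPulls ν (softElim σ (Real.sqrt 8)) n i).toReal
        ≤ d * (7 + 16 * Real.log n / d ^ 2 + 32 / d ^ 2) := mul_le_mul_of_nonneg_left hle hgap.le
      _ = 7 * d + 16 * Real.log n / d + 32 * (1 / d) := by field_simp
      _ ≤ (2 * Real.exp 1 + 6) * d + 16 * Real.log n / d +
            32 * (Real.exp 1 * Real.log n / d) := by
          gcongr
          linarith
      _ = _ := by ring

end Bandit

theorem theorem3 (K : ℕ) [NeZero K] (ν : MeasureTheory.Measure (Fin K → ℝ))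
    [MeasureTheory.IsProbabilityMeasure ν]
    (hbdd : ∀ᵐ y ∂ν, ∀ i : Fin K, y i ∈ Set.Icc (0 : ℝ) 1)
    (hopt : ∀ i : Fin K, i ≠ 0 → Bandit.mean ν i < Bandit.mean ν 0)
    (σ : Equiv.Perm (Fin K)) :
    (∀ n : ℕ,
      Bandit.regret ν (Bandit.softElim σ (Real.sqrt 8)) 0 n ≤
        ∑ i ∈ Finset.univ.filter (fun i : Fin K => i ≠ 0),
          ((2 * Real.exp 1 + 1) * (16 / Bandit.gap ν 0 i * Real.log (n : ℝ) + Bandit.gap ν 0 i)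
            + 5 * Bandit.gap ν 0 i)) ∧
    (fun n : ℕ => Bandit.regret ν (Bandit.softElim σ (Real.sqrt 8)) 0 n)
      =O[Filter.atTop] (fun n : ℕ => Real.log (n : ℝ)) := by
  have hπ := Bandit.isRandomized_softElim σ (Real.sqrt 8)
  have hgap (i : Fin K) (hi : i ≠ 0) : 0 < Bandit.gap ν 0 i := sub_pos.2 (hopt i hi)
  have hbound (n : ℕ) : Bandit.regret ν (Bandit.softElim σ (Real.sqrt 8)) 0 n ≤
      ∑ i ∈ Finset.univ.filter (fun i : Fin K => i ≠ 0),
        ((2 * Real.exp 1 + 1) * (16 / Bandit.gap ν 0 i * Real.log (n : ℝ) + Bandit.gap ν 0 i)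
          + 5 * Bandit.gap ν 0 i) := by
    rw [Bandit.regret_eq_sum_gap_mul hπ hbdd, ← Finset.sum_filter_of_ne (p := fun i => i ≠ 0)]
    · exact Finset.sum_le_sum fun i hi => Bandit.gap_mul_expectedPulls_softElim_le hbdd σ
        (hgap i (Finset.mem_filter.1 hi).2) n
    · rintro i - hne rfl
      exact hne (by rw [Bandit.gap_self, zero_mul])
  refine ⟨hbound, ?_⟩
  refine Asymptotics.IsBigO.of_bound (∑ i ∈ Finset.univ.filter (fun i : Fin K => i ≠ 0),
    ((2 * Real.exp 1 + 1) * (16 / Bandit.gap ν 0 i + Bandit.gap ν 0 i)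
      + 5 * Bandit.gap ν 0 i)) ?_
  -- From `n = 3 > e` on, `log n ≥ 1`, so the constant terms are also at most multiples of `log n`.
  filter_upwards [Filter.eventually_ge_atTop 3] with n hn
  have hlog : 1 ≤ Real.log n := by
    have hn' : (3 : ℝ) ≤ n := by exact_mod_cast hn
    rw [Real.le_log_iff_exp_le (by linarith)]
    linarith [Real.exp_one_lt_d9]
  have hnonneg : 0 ≤ Bandit.regret ν (Bandit.softElim σ (Real.sqrt 8)) 0 n := by
    rw [Bandit.regret_eq_sum_gap_mul hπ hbdd]
    refine Finset.sum_nonneg fun i _ => mul_nonneg ?_ ENNReal.toReal_nonneg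
    by_cases hi : i = 0
    · rw [hi, Bandit.gap_self]
    · exact (hgap i hi).le
  rw [Real.norm_of_nonneg hnonneg, Real.norm_of_nonneg (by linarith), Finset.sum_mul]
  refine (hbound n).trans (Finset.sum_le_sum fun i hi => ?_)
  have hd := hgap i (Finset.mem_filter.1 hi).2
  have hd' : Bandit.gap ν 0 i ≤ Bandit.gap ν 0 i * Real.log n := le_mul_of_one_le_right hd.le hlog
  calc (2 * Real.exp 1 + 1) * (16 / Bandit.gap ν 0 i * Real.log (n : ℝ) + Bandit.gap ν 0 i)
        + 5 * Bandit.gap ν 0 i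
      ≤ (2 * Real.exp 1 + 1) * (16 / Bandit.gap ν 0 i * Real.log (n : ℝ) +
          Bandit.gap ν 0 i * Real.log n) + 5 * (Bandit.gap ν 0 i * Real.log n) := by
        gcongr
    _ = _ := by ring
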